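/- For $r\in[1,2]$, a symmetric Weibull random variable with parameter $r$ is a real random variable $X$ such that $-X$ has the same law as $X$ and $\mathbb P(|X|\ge t)=\exp(-t^r)$ for every $t\ge 0$. Put $\varphi_r(x)=\exp(2-2x^{-r})$ for $x>0$ and $\varphi_r(0)=0$, and for a finite real sequence $(d_i)_{i\in I}$ put $$\|(d_i)_{i\in I}\|_{\varphi_r}=\inf\Bigl\{t>0:\ \sum_{i\in I}\varphi_r(|d_i|/t)\le 1\Bigr\},$$ and let $\|\cdot\|_\rho$ denote the usual $\ell_\rho$-norm. Norms of empty sequences are $0$. There is a universal constant $C>0$ such that the following holds. Let $r\in[1,2]$, let $k$ be a nonnegative integer, and let $X_1,\dots,X_k$ be independent symmetric Weibull random variables with parameter $r$. Then for every $1\le\rho\le\infty$ and every $c=(c_i)_{i=1}^k\in\mathbb R^k$ the random variable $\|(c_iX_i)_{i=1}^k\|_\rho$ is integrable and $$\frac1C\Bigl(\|(c_i^*)_{i\le e^\rho}\|_{\varphi_r}+\rho^{1/r}\|(c_i^*)_{i>e^\rho}\|_\rho\Bigr)\ \le\ \mathbb E\bigl\|(c_iX_i)_{i=1}^k\bigr\|_\rho\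 \le\ C\Bigl(\|(c_i^*)_{i\le e^\rho}\|_{\varphi_r}+\rho^{1/r}\|(c_i^*)_{i>e^\rho}\|_\rho\Bigr),$$ where $(c_i^*)_{i=1}^k$ is the nonincreasing rearrangement of $(|c_i|)_{i=1}^k$. For $\rho=\infty$ we use $e^\infty=\infty$, so the first sequence is all of $(c_i^*)_{i\le k}$ and the second summand is $0$. -/

import Mathlib

open MeasureTheory ProbabilityTheory
open scoped ENNReal

namespace WeibullSeq

/-- `X` is a symmetric Weibull random variable with (shape) parameter `r`: it has the same law as
`-X`, and `P(|X| ≥ t) = exp (-t ^ r)` for every `t ≥ 0`. -/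
structure IsSymmetricWeibull {Ω : Type*} [MeasurableSpace Ω] (r : ℝ) (X : Ω → ℝ)
    (P : Measure Ω) : Prop where
  measurable : Measurable X
  symmetric : P.map (fun ω => -X ω) = P.map X
  tail : ∀ t : ℝ, 0 ≤ t → P {ω | t ≤ |X ω|} = ENNReal.ofReal (Real.exp (-t ^ r))

/-- `φ_r(t) = exp (2 - 2 t ^ (-r))` for `t > 0`, and `φ_r(0) = 0`. -/
noncomputable def phi (r t : ℝ) : ℝ :=
  if 0 < t then Real.exp (2 - 2 * t ^ (-r)) else 0

/-- The norm `‖(c_i)‖_{φ_r} = inf {t > 0 : ∑ φ_r(|c_i| / t) ≤ 1}` of a finite family. -/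
noncomputable def phiNorm {ι : Type*} [Fintype ι] (r : ℝ) (c : ι → ℝ) : ℝ :=
  sInf {t : ℝ | 0 < t ∧ ∑ i, phi r (|c i| / t) ≤ 1}

/-- The norm `‖(c_i)‖_ρ` of a finite family, `1 ≤ ρ ≤ ∞`. -/
noncomputable def ellNorm {ι : Type*} [Fintype ι] (ρ : ℝ≥0∞) (c : ι → ℝ) : ℝ :=
  ‖WithLp.toLp ρ c‖

/-- The nonincreasing rearrangement `(c_i^*)` of `(|c_i|)`; the entry `c_i^*` of the mathematical
text, `1 ≤ i ≤ k`, has index `i - 1` in `Fin k`. -/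
noncomputable def rearr {k : ℕ} (c : Fin k → ℝ) : Fin k → ℝ :=
  fun i => |c (Tuple.sort (fun j => -|c j|) i)|

theorem rearr_antitone {k : ℕ} (c : Fin k → ℝ) : Antitone (rearr c) := by
  intro i j hij
  have h := Tuple.monotone_sort (fun j => -|c j|) hij
  simpa [rearr] using h

theorem rearr_eq_comp_perm {k : ℕ} (c : Fin k → ℝ) :
    ∃ σ : Equiv.Perm (Fin k), ∀ i, rearr c i = |c (σ i)| :=
  ⟨Tuple.sort (fun j => -|c j|), fun _ => rfl⟩

/-- The indices at (1-based) positions `i ≤ e ^ ρ`, where `e ^ ∞ = ∞`. -/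
noncomputable def head (k : ℕ) (ρ : ℝ≥0∞) : Finset (Fin k) :=
  {i | (((i : ℕ) + 1 : ℕ) : ℝ≥0∞) ≤ EReal.exp (ρ : EReal)}

/-- The indices at (1-based) positions `i > e ^ ρ`, where `e ^ ∞ = ∞`. -/
noncomputable def tail (k : ℕ) (ρ : ℝ≥0∞) : Finset (Fin k) :=
  {i | EReal.exp (ρ : EReal) < (((i : ℕ) + 1 : ℕ) : ℝ≥0∞)}

/-- `‖(c_i^*)_{i ≤ e^ρ}‖_{φ_r} + ρ^{1/r} ‖(c_i^*)_{i > e^ρ}‖_ρ`. For `ρ = ∞` the second family is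
empty, so that the second summand is `0`. -/
noncomputable def weibullBound {k : ℕ} (r : ℝ) (ρ : ℝ≥0∞) (c : Fin k → ℝ) : ℝ :=
  phiNorm r (fun i : head k ρ => rearr c i) +
    ρ.toReal ^ (1 / r) * ellNorm ρ (fun i : tail k ρ => rearr c i)

end WeibullSeq

namespace WeibullSeq

/-! ### Moments and unions for symmetric Weibull variables -/

section Probability

variable {Ω : Type*} [MeasurableSpace Ω] {P : Measure Ω} [IsProbabilityMeasure P]

/-! The upper bound needs only `E exp(|X|^r/2) ≤ 2`. The head has at most `e^ρ` entries, so there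
the `ℓ_ρ`-norm is at most `e` times the maximum; `mul_le_add_phi_mul_exp` bounds the maximum by a
sum of exponentials weighted by `φ_r`. On the tail, `rpow_le_mul_exp` replaces `|X_i|^ρ` by
`(ρ^(1/r))^ρ exp(|X_i|^r/2)`. Independence plays no part.

The lower bound uses independence through `one_sub_exp_le_prob_exists`. Head: if `∑ φ_r(|d_i|/t) >
1`, then `∑ P(|d_i X_i| ≥ t) ≥ e^(-2)`, so some term exceeds `t` with probability bounded below, and
Markov's inequality applies. Tail: `P(|X| ≥ ρ^(1/r)) = e^(-ρ)`, so among the `⌊e^ρ⌋` indices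
preceding `i` some `|X_l| ≥ ρ^(1/r)` with probability bounded below, and then `d_l |X_l| ≥ d_i
ρ^(1/r)` by monotonicity. Each `l` serves at most `e^ρ` indices `i`, which costs a factor `e` in
`ℓ_ρ`; Jensen's inequality finishes. -/

theorem IsSymmetricWeibull.lintegral_exp_le {r : ℝ} (hr : 0 < r) {X : Ω → ℝ}
    (h : IsSymmetricWeibull r X P) :
    ∫⁻ ω, ENNReal.ofReal (Real.exp (|X ω| ^ r / 2)) ∂P ≤ 2 := by
  have hm : Measurable fun ω => Real.exp (|X ω| ^ r / 2) := by
    exact ((h.measurable.abs.pow_const r).div_const 2).exp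
  -- Layer cake: levels `t ≤ 1` contribute at most 1, and above 1 the tail is exactly `t^(-2)`, with
  -- integral 1.
  rw [lintegral_eq_lintegral_meas_le P (ae_of_all _ fun ω => (Real.exp_pos _).le) hm.aemeasurable,
    ← Set.Ioc_union_Ioi_eq_Ioi (zero_le_one (α := ℝ)),
    lintegral_union measurableSet_Ioi (Set.Ioc_disjoint_Ioi le_rfl)]
  have h1 : ∫⁻ t in Set.Ioc (0 : ℝ) 1, P {ω | t ≤ Real.exp (|X ω| ^ r / 2)} ≤ 1 := by
    calc _ ≤ ∫⁻ t in Set.Ioc (0 : ℝ) 1, 1 := lintegral_mono fun t => prob_le_one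
      _ = 1 := by simp
  have h2 : ∫⁻ t in Set.Ioi (1 : ℝ), P {ω | t ≤ Real.exp (|X ω| ^ r / 2)} ≤ 1 := by
    have e : ∀ t ∈ Set.Ioi (1 : ℝ), P {ω | t ≤ Real.exp (|X ω| ^ r / 2)}
        = ENNReal.ofReal (t ^ (-2 : ℝ)) := by
      intro t ht
      have ht' : (1 : ℝ) < t := ht
      have ht0 : 0 < t := by linarith
      have hl : 0 ≤ 2 * Real.log t := by have := Real.log_pos ht'; linarith
      have hs : {ω | t ≤ Real.exp (|X ω| ^ r / 2)} = {ω | (2 * Real.log t) ^ (1 / r) ≤ |X ω|} := by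
        ext ω
        simp only [Set.mem_ofPred_eq]
        rw [← Real.log_le_iff_le_exp ht0, one_div,
          Real.rpow_inv_le_iff_of_pos hl (abs_nonneg _) hr]
        constructor <;> intro h <;> linarith
      rw [hs, h.tail _ (Real.rpow_nonneg hl _), ← Real.rpow_mul hl, one_div_mul_cancel hr.ne',
        Real.rpow_one, Real.rpow_def_of_pos ht0]
      congr 2
      ring
    rw [setLIntegral_congr_fun measurableSet_Ioi e,
      ← ofReal_integral_eq_lintegral_ofReal (integrableOn_Ioi_rpow_of_lt (by norm_num) one_pos)
        ((ae_restrict_iff' measurableSet_Ioi).2 (ae_of_all _ fun t ht => Real.rpow_nonneg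
          (zero_le_one.trans (Set.mem_Ioi.1 ht).le) _)),
      integral_Ioi_rpow_of_lt (by norm_num) one_pos]
    norm_num
  calc _ ≤ (1 : ℝ≥0∞) + 1 := add_le_add h1 h2
    _ = 2 := one_add_one_eq_two

theorem IsSymmetricWeibull.integrable_exp {r : ℝ} (hr : 0 < r) {X : Ω → ℝ}
    (h : IsSymmetricWeibull r X P) :
    Integrable (fun ω => Real.exp (|X ω| ^ r / 2)) P := by
  have hm : Measurable fun ω => Real.exp (|X ω| ^ r / 2) :=
    ((h.measurable.abs.pow_const r).div_const 2).exp
  refine ⟨hm.aestronglyMeasurable, ?_⟩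
  rw [hasFiniteIntegral_iff_ofReal (ae_of_all _ fun ω => (Real.exp_pos _).le)]
  exact (h.lintegral_exp_le hr).trans_lt (by simp)

theorem IsSymmetricWeibull.integral_exp_le {r : ℝ} (hr : 0 < r) {X : Ω → ℝ}
    (h : IsSymmetricWeibull r X P) :
    ∫ ω, Real.exp (|X ω| ^ r / 2) ∂P ≤ 2 := by
  have := ofReal_integral_eq_lintegral_ofReal (h.integrable_exp hr)
    (ae_of_all _ fun ω => (Real.exp_pos _).le)
  have h2 := h.lintegral_exp_le hr
  rw [← this] at h2
  rwa [ENNReal.ofReal_le_ofNat] at h2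

/-- Powers of nonnegative reals are dominated by the exponential with a sharp order constant. -/
theorem rpow_le_mul_exp {r q y : ℝ} (hr : 1 ≤ r) (hq : 0 < q) (hy : 0 ≤ y) :
    y ^ q ≤ (q ^ (1 / r)) ^ q * Real.exp (y ^ r / 2) := by
  have hr0 : 0 < r := by linarith
  have hs : 0 < q / r := div_pos hq hr0
  have hv : 0 ≤ y ^ r := Real.rpow_nonneg hy r
  -- This is `u ≤ exp(u - 1)`, with `u` scaled so that raising to the power `q/r` produces
  -- `exp(y^r/2)`.
  have h1 : y ^ r / (2 * (q / r)) ≤ Real.exp (y ^ r / (2 * (q / r)) - 1) := by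
    have := Real.add_one_le_exp (y ^ r / (2 * (q / r)) - 1); linarith
  have h2 : y ^ r ≤ (2 * (q / r)) * Real.exp (y ^ r / (2 * (q / r)) - 1) := by
    rwa [div_le_iff₀' (by positivity)] at h1
  have h3 : y ^ r ≤ q * Real.exp (y ^ r / (2 * (q / r))) := by
    refine h2.trans ?_
    have he : (2 : ℝ) ≤ Real.exp 1 := by have := Real.add_one_le_exp (1 : ℝ); linarith
    have hqr : q / r ≤ q := div_le_self hq.le hr
    rw [Real.exp_sub]
    have : 2 * (q / r) / Real.exp 1 ≤ q := by
      rw [div_le_iff₀ (Real.exp_pos _)]; nlinarith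
    calc 2 * (q / r) * (Real.exp (y ^ r / (2 * (q / r))) / Real.exp 1)
        = 2 * (q / r) / Real.exp 1 * Real.exp (y ^ r / (2 * (q / r))) := by ring
      _ ≤ _ := mul_le_mul_of_nonneg_right this (Real.exp_pos _).le
  calc y ^ q = (y ^ r) ^ (q / r) := by
        rw [← Real.rpow_mul hy]; congr 1; field_simp
    _ ≤ (q * Real.exp (y ^ r / (2 * (q / r)))) ^ (q / r) := Real.rpow_le_rpow hv h3 hs.le
    _ = _ := by
        rw [Real.mul_rpow hq.le (Real.exp_pos _).le, ← Real.rpow_mul hq.le, ← Real.exp_mul]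
        congr 2
        · ring
        · field_simp

theorem IsSymmetricWeibull.integrable {r : ℝ} (hr : 1 ≤ r) {X : Ω → ℝ}
    (h : IsSymmetricWeibull r X P) : Integrable X P := by
  refine (h.integrable_exp (by linarith)).mono' h.measurable.aestronglyMeasurable
    (ae_of_all _ fun ω => ?_)
  have := rpow_le_mul_exp (q := 1) hr one_pos (abs_nonneg (X ω))
  simpa using this

/-- By independence the complement has probability `∏ (1 - exp(-s_i^r))`, and `1 - x ≤ exp(-x)`
bounds each factor. -/
theorem one_sub_exp_le_prob_exists {r : ℝ} {k : ℕ} {X : Fin k → Ω → ℝ}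
    (h : ∀ i, IsSymmetricWeibull r (X i) P) (hX : iIndepFun X P) (S : Finset (Fin k))
    (s : Fin k → ℝ) (hs : ∀ i ∈ S, 0 ≤ s i) {l : ℝ}
    (hl : l ≤ ∑ i ∈ S, Real.exp (-(s i) ^ r)) :
    1 - Real.exp (-l) ≤ P.real {ω | ∃ i ∈ S, s i ≤ |X i ω|} := by
  have hmA : ∀ i, MeasurableSet {x : ℝ | s i ≤ |x|} := fun i =>
    measurableSet_le measurable_const measurable_id.abs
  have hc : {ω | ∃ i ∈ S, s i ≤ |X i ω|}ᶜ = ⋂ i ∈ S, X i ⁻¹' {x : ℝ | s i ≤ |x|}ᶜ := by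
    ext ω; simp
  have hm : MeasurableSet {ω | ∃ i ∈ S, s i ≤ |X i ω|} := by
    rw [← MeasurableSet.compl_iff, hc]
    exact Finset.measurableSet_biInter _ fun i _ => (h i).measurable (hmA i).compl
  have h1 : P.real {ω | ∃ i ∈ S, s i ≤ |X i ω|}ᶜ
      = ∏ i ∈ S, (1 - Real.exp (-(s i) ^ r)) := by
    rw [hc, measureReal_def, hX.measure_inter_preimage_eq_mul S (fun i _ => (hmA i).compl),
      ENNReal.toReal_prod]
    refine Finset.prod_congr rfl fun i hi => ?_
    rw [← measureReal_def, Set.preimage_compl, probReal_compl_eq_one_sub ((h i).measurable (hmA i))]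
    congr 1
    have := (h i).tail (s i) (hs i hi)
    rw [measureReal_def]
    change (P {ω | s i ≤ |X i ω|}).toReal = _
    rw [this, ENNReal.toReal_ofReal (Real.exp_pos _).le]
  have h2 : ∏ i ∈ S, (1 - Real.exp (-(s i) ^ r)) ≤ Real.exp (-l) := by
    calc _ ≤ ∏ i ∈ S, Real.exp (-Real.exp (-(s i) ^ r)) := by
          refine Finset.prod_le_prod (fun i hi => ?_) fun i hi => ?_
          · have : Real.exp (-(s i) ^ r) ≤ 1 :=
              Real.exp_le_one_iff.2 (by have := Real.rpow_nonneg (hs i hi) r; linarith)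
            linarith
          · have := Real.add_one_le_exp (-Real.exp (-(s i) ^ r)); linarith
      _ = Real.exp (-∑ i ∈ S, Real.exp (-(s i) ^ r)) := by
          rw [← Real.exp_sum, Finset.sum_neg_distrib]
      _ ≤ _ := Real.exp_le_exp.2 (by linarith)
  rw [← h1, probReal_compl_eq_one_sub hm] at h2
  linarith

end Probability

/-! ### The norms -/

theorem ellNorm_eq_sum {ι : Type*} [Fintype ι] {ρ : ℝ≥0∞} (h1 : 1 ≤ ρ) (h : ρ ≠ ∞) (f : ι → ℝ) :
    ellNorm ρ f = (∑ i, |f i| ^ ρ.toReal) ^ (1 / ρ.toReal) := by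
  have : 0 < ρ.toReal := ENNReal.toReal_pos (by rintro rfl; simp at h1) h
  simp [ellNorm, PiLp.norm_eq_sum this]

theorem ellNorm_top {ι : Type*} [Fintype ι] (f : ι → ℝ) : ellNorm ∞ f = ⨆ i, |f i| := by
  simp [ellNorm, PiLp.norm_eq_ciSup]

theorem ellNorm_eq_norm {ι : Type*} [Fintype ι] {ρ : ℝ≥0∞} [Fact (1 ≤ ρ)] (f : ι → ℝ) :
    ellNorm ρ f = ‖(WithLp.toLp ρ f : PiLp ρ fun _ : ι => ℝ)‖ := rfl

theorem ellNorm_nonneg {ι : Type*} [Fintype ι] {ρ : ℝ≥0∞} (h1 : 1 ≤ ρ) (f : ι → ℝ) :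
    0 ≤ ellNorm ρ f := by
  have : Fact (1 ≤ ρ) := ⟨h1⟩
  rw [ellNorm_eq_norm]; exact norm_nonneg _

theorem ellNorm_mono {ι : Type*} [Fintype ι] {ρ : ℝ≥0∞} (h1 : 1 ≤ ρ) {f g : ι → ℝ}
    (h : ∀ i, |f i| ≤ |g i|) : ellNorm ρ f ≤ ellNorm ρ g := by
  by_cases hρ : ρ = ∞
  · subst hρ
    rw [ellNorm_top, ellNorm_top]
    exact ciSup_mono (Finite.bddAbove_range _) h
  · rw [ellNorm_eq_sum h1 hρ, ellNorm_eq_sum h1 hρ]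
    refine Real.rpow_le_rpow (Finset.sum_nonneg fun i _ => by positivity) ?_ (by positivity)
    exact Finset.sum_le_sum fun i _ => Real.rpow_le_rpow (abs_nonneg _) (h i) (by positivity)

theorem ellNorm_congr {ι : Type*} [Fintype ι] {ρ : ℝ≥0∞} (h1 : 1 ≤ ρ) {f g : ι → ℝ}
    (h : ∀ i, |f i| = |g i|) : ellNorm ρ f = ellNorm ρ g :=
  le_antisymm (ellNorm_mono h1 fun i => (h i).le) (ellNorm_mono h1 fun i => (h i).ge)

theorem ellNorm_comp_equiv {ι : Type*} [Fintype ι] {ρ : ℝ≥0∞} (h1 : 1 ≤ ρ) (f : ι → ℝ)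
    (σ : Equiv.Perm ι) : ellNorm ρ (fun i => f (σ i)) = ellNorm ρ f := by
  by_cases hρ : ρ = ∞
  · subst hρ
    rw [ellNorm_top, ellNorm_top]
    exact σ.surjective.iSup_comp fun i => |f i|
  · rw [ellNorm_eq_sum h1 hρ, ellNorm_eq_sum h1 hρ]
    rw [Equiv.sum_comp σ fun i => |f i| ^ ρ.toReal]

theorem ellNorm_add_le {ι : Type*} [Fintype ι] {ρ : ℝ≥0∞} (h1 : 1 ≤ ρ) (f g : ι → ℝ) :
    ellNorm ρ (fun i => f i + g i) ≤ ellNorm ρ f + ellNorm ρ g := by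
  have : Fact (1 ≤ ρ) := ⟨h1⟩
  exact norm_add_le (WithLp.toLp ρ f : PiLp ρ fun _ : ι => ℝ) (WithLp.toLp ρ g)

theorem abs_le_ellNorm {ι : Type*} [Fintype ι] {ρ : ℝ≥0∞} (h1 : 1 ≤ ρ) (f : ι → ℝ) (i : ι) :
    |f i| ≤ ellNorm ρ f := by
  have : Fact (1 ≤ ρ) := ⟨h1⟩
  exact PiLp.norm_apply_le (WithLp.toLp ρ f : PiLp ρ fun _ : ι => ℝ) i

theorem ellNorm_const_mul {ι : Type*} [Fintype ι] {ρ : ℝ≥0∞} (h1 : 1 ≤ ρ) {a : ℝ} (ha : 0 ≤ a)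
    (f : ι → ℝ) : ellNorm ρ (fun i => a * f i) = a * ellNorm ρ f := by
  have : Fact (1 ≤ ρ) := ⟨h1⟩
  have := norm_smul a (WithLp.toLp ρ f : PiLp ρ fun _ : ι => ℝ)
  rw [Real.norm_of_nonneg ha] at this
  exact this

theorem ellNorm_restrict {ι : Type*} [Fintype ι] [DecidableEq ι] {ρ : ℝ≥0∞} (h1 : 1 ≤ ρ)
    (h : ρ ≠ ∞) (S : Finset ι) (f : ι → ℝ) :
    ellNorm ρ (fun i : S => f i) = (∑ i ∈ S, |f i| ^ ρ.toReal) ^ (1 / ρ.toReal) := by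
  rw [ellNorm_eq_sum h1 h, Finset.sum_coe_sort S (fun i => |f i| ^ ρ.toReal)]

theorem ellNorm_ite {ι : Type*} [Fintype ι] [DecidableEq ι] {ρ : ℝ≥0∞} (h1 : 1 ≤ ρ)
    (h : ρ ≠ ∞) (S : Finset ι) (f : ι → ℝ) :
    ellNorm ρ (fun i => if i ∈ S then f i else 0)
      = (∑ i ∈ S, |f i| ^ ρ.toReal) ^ (1 / ρ.toReal) := by
  have hp : 0 < ρ.toReal := ENNReal.toReal_pos (by rintro rfl; simp at h1) h
  rw [ellNorm_eq_sum h1 h]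
  congr 1
  rw [← Finset.sum_subset (Finset.subset_univ S)]
  · exact Finset.sum_congr rfl fun i hi => by simp [hi]
  · intro i _ hi
    simp [hi, Real.zero_rpow hp.ne']

/-! ### The function `φ_r` -/

theorem phi_nonneg (r t : ℝ) : 0 ≤ phi r t := by
  unfold phi; split_ifs
  · exact (Real.exp_pos _).le
  · exact le_rfl

theorem phi_zero (r : ℝ) : phi r 0 = 0 := by simp [phi]

theorem phi_le_self {r x : ℝ} (hr : 1 ≤ r) (h0 : 0 ≤ x) (h1 : x ≤ 1) : phi r x ≤ x := by
  rcases h0.eq_or_lt with rfl | h0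
  · simp [phi_zero]
  have hx : 1 / x ≤ x ^ (-r) := by
    rw [Real.rpow_neg h0.le, ← one_div]
    refine one_div_le_one_div_of_le (Real.rpow_pos_of_pos h0 r) ?_
    simpa using Real.rpow_le_rpow_of_exponent_ge h0 h1 hr
  have h2 : 1 ≤ 1 / x := by rw [le_div_iff₀ h0]; linarith
  have h3 : 1 / x ≤ Real.exp (2 * x ^ (-r) - 2) := by
    have := Real.add_one_le_exp (2 * x ^ (-r) - 2); linarith
  have h4 : phi r x = (Real.exp (2 * x ^ (-r) - 2))⁻¹ := by
    rw [← Real.exp_neg, phi, if_pos h0]; congr 1; ring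
  rw [h4]
  calc _ ≤ (1 / x)⁻¹ := inv_anti₀ (by positivity) h3
    _ = x := by simp

theorem le_one_of_phi_le_one {r x : ℝ} (hr : 0 < r) (h : phi r x ≤ 1) : x ≤ 1 := by
  by_contra! hx
  have hx0 : 0 < x := by linarith
  rw [phi, if_pos hx0, Real.exp_le_one_iff] at h
  have : x ^ (-r) < 1 := Real.rpow_lt_one_of_one_lt_of_neg hx (by linarith)
  linarith

/-- Rules out the default value 0 of `sInf ∅`; since `φ_r(x) ≤ x` on `[0,1]`, `t = ‖c‖₁ + 1` is
admissible. -/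
theorem exists_sum_phi_le_one {ι : Type*} [Fintype ι] {r : ℝ} (hr : 1 ≤ r) (c : ι → ℝ) :
    {t : ℝ | 0 < t ∧ ∑ i, phi r (|c i| / t) ≤ 1}.Nonempty := by
  have hS : 0 ≤ ∑ i, |c i| := Finset.sum_nonneg fun i _ => abs_nonneg _
  have ht : 0 < ∑ i, |c i| + 1 := by linarith
  refine ⟨∑ i, |c i| + 1, ht, ?_⟩
  calc _ ≤ ∑ i, |c i| / (∑ i, |c i| + 1) := by
        refine Finset.sum_le_sum fun i hi => phi_le_self hr (by positivity) ?_
        rw [div_le_one ht]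
        have := Finset.single_le_sum (f := fun i => |c i|) (fun i _ => abs_nonneg _) hi
        linarith
    _ = (∑ i, |c i|) / (∑ i, |c i| + 1) := by rw [Finset.sum_div]
    _ ≤ 1 := by rw [div_le_one ht]; linarith

theorem phi_le_exp_mul {r x : ℝ} (hx : 0 < x) :
    phi r x ≤ Real.exp 2 * Real.exp (-(1 / x) ^ r) := by
  rw [phi, if_pos hx, ← Real.exp_add, one_div, Real.inv_rpow hx.le, ← Real.rpow_neg hx.le]
  have := Real.rpow_nonneg hx.le (-r)
  exact Real.exp_le_exp.2 (by linarith)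

/-- A truncated linear bound through the exponential moment, with the weight `φ_r`. -/
theorem mul_le_add_phi_mul_exp {r x y : ℝ} (hr : 1 ≤ r) (h0 : 0 ≤ x) (h1 : x ≤ 1) (hy : 0 ≤ y) :
    x * y ≤ 8 + 4 * phi r x * Real.exp (y ^ r / 2) := by
  have hp := phi_nonneg r x
  by_cases h8 : x * y ≤ 8
  · have := mul_nonneg (mul_nonneg zero_le_four hp) (Real.exp_pos (y ^ r / 2)).le
    linarith
  push Not at h8
  have hx : 0 < x := h0.lt_of_ne (by rintro rfl; simp at h8; linarith)
  have hy8 : x * y ≤ y := by nlinarith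
  have hyr : y ≤ y ^ r := by
    simpa using Real.rpow_le_rpow_of_exponent_le (by linarith : 1 ≤ y) hr
  -- The cutoff 8 makes `y^r/4 ≥ 2 x^(-r)`, so a quarter of `y^r` pays for the small factor
  -- `φ_r(x)`.
  have hv : 8 * x ^ (-r) ≤ y ^ r := by
    have h9 : (8 : ℝ) ≤ (x * y) ^ r := by
      calc (8 : ℝ) ≤ x * y := h8.le
        _ = (x * y) ^ (1 : ℝ) := by simp
        _ ≤ _ := Real.rpow_le_rpow_of_exponent_le (by linarith) hr
    rw [Real.mul_rpow h0 hy] at h9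
    have hxr := Real.rpow_pos_of_pos hx r
    rw [Real.rpow_neg h0, ← div_eq_mul_inv, div_le_iff₀ hxr]
    linarith
  have h2 : y ^ r ≤ 4 * Real.exp (y ^ r / 4) := by
    have := Real.add_one_le_exp (y ^ r / 4); linarith
  have h3 : Real.exp (y ^ r / 4) ≤ phi r x * Real.exp (y ^ r / 2) := by
    rw [phi, if_pos hx, ← Real.exp_add]
    exact Real.exp_le_exp.2 (by linarith)
  linarith

end WeibullSeq

namespace WeibullSeq

/-! ### The index sets `head` and `tail` -/

theorem mem_tail_iff {k : ℕ} {ρ : ℝ≥0∞} {i : Fin k} : i ∈ tail k ρ ↔ i ∉ head k ρ := by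
  simp [tail, head]

theorem mem_tail_iff_lt {k : ℕ} {ρ : ℝ≥0∞} (h : ρ ≠ ∞) {i : Fin k} :
    i ∈ tail k ρ ↔ Real.exp ρ.toReal < (i : ℝ) + 1 := by
  lift ρ to NNReal using h
  have e : (((ρ : ℝ≥0∞) : EReal)) = ((ρ : ℝ) : EReal) := rfl
  simp only [tail, Finset.mem_filter, Finset.mem_univ, true_and]
  rw [e, EReal.exp_coe, ← ENNReal.ofReal_natCast, ENNReal.ofReal_lt_ofReal_iff (by positivity)]
  simp

theorem mem_head_iff_le {k : ℕ} {ρ : ℝ≥0∞} (h : ρ ≠ ∞) {i : Fin k} :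
    i ∈ head k ρ ↔ (i : ℝ) + 1 ≤ Real.exp ρ.toReal := by
  rw [← not_lt, ← mem_tail_iff_lt h, mem_tail_iff, not_not]

theorem head_top (k : ℕ) : head k ∞ = Finset.univ := by
  ext i; simp [head]

theorem tail_top (k : ℕ) : tail k ∞ = ∅ := by
  ext i; simp [mem_tail_iff, head_top]

theorem card_head_le {k : ℕ} {ρ : ℝ≥0∞} (h : ρ ≠ ∞) :
    ((head k ρ).card : ℝ) ≤ Real.exp ρ.toReal := by
  refine le_trans ?_ (Nat.floor_le (Real.exp_pos ρ.toReal).le)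
  norm_cast
  rw [← Finset.card_range ⌊Real.exp ρ.toReal⌋₊]
  refine Finset.card_le_card_of_injOn (fun i => (i : ℕ)) (fun i hi => ?_)
    (Fin.val_injective.injOn)
  have := (mem_head_iff_le h).1 (by simpa using hi)
  simp only [Finset.coe_range, Set.mem_Iio]
  rw [← Nat.succ_le_iff]
  exact Nat.le_floor (by push_cast; exact this)

theorem rpow_one_div_le_exp_one {p x : ℝ} (hp : 0 < p) (h0 : 0 ≤ x) (hx : x ≤ Real.exp p) :
    x ^ (1 / p) ≤ Real.exp 1 := by
  calc x ^ (1 / p) ≤ (Real.exp p) ^ (1 / p) := Real.rpow_le_rpow h0 hx (by positivity)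
    _ = Real.exp 1 := by rw [← Real.exp_mul, mul_one_div_cancel hp.ne']

/-- The head has `n ≤ e^ρ` entries, hence `n^(1/ρ) ≤ e`. -/
theorem ellNorm_head_le {k : ℕ} {ρ : ℝ≥0∞} (h1 : 1 ≤ ρ) {f : Fin k → ℝ} {M : ℝ} (hM : 0 ≤ M)
    (hf : ∀ i ∈ head k ρ, |f i| ≤ M) :
    ellNorm ρ (fun i => if i ∈ head k ρ then f i else 0) ≤ Real.exp 1 * M := by
  by_cases h : ρ = ∞
  · subst h
    rw [ellNorm_top]
    have he : M ≤ Real.exp 1 * M := le_mul_of_one_le_left hM (Real.one_le_exp zero_le_one)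
    refine Real.iSup_le (fun i => ?_) (by positivity)
    split_ifs with hi
    · exact (hf i hi).trans he
    · simpa using hM.trans he
  · have hp : 0 < ρ.toReal := ENNReal.toReal_pos (by rintro rfl; simp at h1) h
    rw [ellNorm_ite h1 h]
    calc _ ≤ ((head k ρ).card * M ^ ρ.toReal) ^ (1 / ρ.toReal) := by
          refine Real.rpow_le_rpow (Finset.sum_nonneg fun i _ => by positivity) ?_ (by positivity)
          rw [← nsmul_eq_mul]
          exact Finset.sum_le_card_nsmul _ _ _ fun i hi =>
            Real.rpow_le_rpow (abs_nonneg _) (hf i hi) hp.le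
      _ = ((head k ρ).card : ℝ) ^ (1 / ρ.toReal) * M := by
          rw [Real.mul_rpow (by positivity) (by positivity), ← Real.rpow_mul hM,
            mul_one_div_cancel hp.ne', Real.rpow_one]
      _ ≤ _ := mul_le_mul_of_nonneg_right
          (rpow_one_div_le_exp_one hp (by positivity) (card_head_le h)) hM

theorem rpow_one_div_le_one_add {p u : ℝ} (hp : 1 ≤ p) (hu : 0 ≤ u) : u ^ (1 / p) ≤ 1 + u := by
  rcases le_total u 1 with h | h
  · have := Real.rpow_le_one hu h (by positivity : 0 ≤ 1 / p); linarith
  · have : u ^ (1 / p) ≤ u ^ (1 : ℝ) :=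
      Real.rpow_le_rpow_of_exponent_le h (by rw [div_le_one (by linarith)]; exact hp)
    rw [Real.rpow_one] at this; linarith

/-- The weights are the normalised `|d_i|^ρ`. Replacing the root `W^(1/ρ)` by `1 + W` makes the
bound affine in the exponentials, so it integrates term by term. -/
theorem ellNorm_mul_le_one_add_sum {ι : Type*} [Fintype ι] [DecidableEq ι] {r : ℝ} (hr : 1 ≤ r)
    {ρ : ℝ≥0∞} (h1 : 1 ≤ ρ) (h : ρ ≠ ∞) (S : Finset ι) (d : ι → ℝ) :
    ∃ w : ι → ℝ, (∀ i, 0 ≤ w i) ∧ ∑ i ∈ S, w i ≤ 1 ∧ ∀ y : ι → ℝ,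
      ellNorm ρ (fun i => if i ∈ S then d i * y i else 0) ≤
        ρ.toReal ^ (1 / r) * ellNorm ρ (fun i : S => d i) *
          (1 + ∑ i ∈ S, w i * Real.exp (|y i| ^ r / 2)) := by
  have hp1 : 1 ≤ ρ.toReal := (ENNReal.ofReal_le_iff_le_toReal h).1 (by simpa using h1)
  have hp : 0 < ρ.toReal := by linarith
  set p := ρ.toReal with hpdef
  set D := ∑ i ∈ S, |d i| ^ p with hD
  have hD0 : 0 ≤ D := Finset.sum_nonneg fun i _ => by positivity
  refine ⟨fun i => |d i| ^ p / D, fun i => by positivity, ?_, fun y => ?_⟩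
  · rw [← Finset.sum_div]
    exact div_self_le_one D
  rw [ellNorm_restrict h1 h, ellNorm_ite h1 h (f := fun i => d i * y i), ← hpdef, ← hD]
  set W := ∑ i ∈ S, |d i| ^ p / D * Real.exp (|y i| ^ r / 2) with hW
  have hW0 : 0 ≤ W := Finset.sum_nonneg fun i _ => by positivity
  have hDW : D * W = ∑ i ∈ S, |d i| ^ p * Real.exp (|y i| ^ r / 2) := by
    rw [hW, Finset.mul_sum]
    refine Finset.sum_congr rfl fun i hi => ?_
    -- If `D = 0`, the weights are 0 by the convention for division, and every `|d i| ^ p` vanishes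
    -- too.
    rcases hD0.eq_or_lt with h0 | h0
    · have hi0 : |d i| ^ p = 0 :=
        (Finset.sum_eq_zero_iff_of_nonneg fun i _ => by positivity).1 (hD.symm.trans h0.symm) i hi
      simp [hi0]
    · field_simp
  have hpr : 0 ≤ p ^ (1 / r) := by positivity
  have key : ∑ i ∈ S, |d i * y i| ^ p ≤ (p ^ (1 / r)) ^ p * (D * W) := by
    rw [hDW, Finset.mul_sum]
    refine Finset.sum_le_sum fun i _ => ?_
    rw [abs_mul, Real.mul_rpow (abs_nonneg _) (abs_nonneg _)]
    have := mul_le_mul_of_nonneg_left (rpow_le_mul_exp hr hp (abs_nonneg (y i)))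
      (by positivity : 0 ≤ |d i| ^ p)
    linarith
  calc _ ≤ ((p ^ (1 / r)) ^ p * (D * W)) ^ (1 / p) :=
        Real.rpow_le_rpow (Finset.sum_nonneg fun i _ => by positivity) key (by positivity)
    _ = p ^ (1 / r) * D ^ (1 / p) * W ^ (1 / p) := by
        rw [Real.mul_rpow (by positivity) (by positivity), ← Real.rpow_mul hpr,
          mul_one_div_cancel hp.ne', Real.rpow_one, Real.mul_rpow hD0 hW0, mul_assoc]
    _ ≤ _ := mul_le_mul_of_nonneg_left (rpow_one_div_le_one_add hp1 hW0) (by positivity)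

/-! ### Upper bounds in expectation and the lower bound for the head -/

section Probability

variable {Ω : Type*} [MeasurableSpace Ω] {P : Measure Ω} [IsProbabilityMeasure P]

theorem integrable_ellNorm {r : ℝ} (hr : 1 ≤ r) {k : ℕ} {X : Fin k → Ω → ℝ}
    (h : ∀ i, IsSymmetricWeibull r (X i) P) {ρ : ℝ≥0∞} (h1 : 1 ≤ ρ) (c : Fin k → ℝ) :
    Integrable (fun ω => ellNorm ρ (fun i => c i * X i ω)) P := by
  have : Fact (1 ≤ ρ) := ⟨h1⟩
  have hv : Integrable (fun ω => (WithLp.toLp ρ (fun i => c i * X i ω) :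
      PiLp ρ fun _ : Fin k => ℝ)) P :=
    Integrable.of_eval_piLp fun i => ((h i).integrable hr).const_mul (c i)
  exact hv.norm

theorem integrable_const_add_sum_exp {r : ℝ} (hr : 1 ≤ r) {k : ℕ} {X : Fin k → Ω → ℝ}
    (h : ∀ i, IsSymmetricWeibull r (X i) P) (S : Finset (Fin k)) (a : ℝ) (b : Fin k → ℝ) :
    Integrable (fun ω => a + ∑ i ∈ S, b i * Real.exp (|X i ω| ^ r / 2)) P :=
  (integrable_const a).add (integrable_finsetSum S fun i _ =>
    ((h i).integrable_exp (by linarith)).const_mul (b i))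

theorem integral_const_add_sum_exp_le {r : ℝ} (hr : 1 ≤ r) {k : ℕ} {X : Fin k → Ω → ℝ}
    (h : ∀ i, IsSymmetricWeibull r (X i) P) (S : Finset (Fin k)) (a : ℝ) {b : Fin k → ℝ}
    (hb : ∀ i, 0 ≤ b i) :
    ∫ ω, (a + ∑ i ∈ S, b i * Real.exp (|X i ω| ^ r / 2)) ∂P ≤ a + 2 * ∑ i ∈ S, b i := by
  have hi : ∀ i ∈ S, Integrable (fun ω => b i * Real.exp (|X i ω| ^ r / 2)) P := fun i _ =>
    ((h i).integrable_exp (by linarith)).const_mul (b i)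
  rw [integral_add (integrable_const a) (integrable_finsetSum S hi), integral_finsetSum S hi,
    Finset.mul_sum]
  simp only [integral_const, probReal_univ, one_smul]
  gcongr with i _
  rw [integral_const_mul, mul_comm]
  exact mul_le_mul_of_nonneg_right ((h i).integral_exp_le (by linarith)) (hb i)

/-- The head of the sequence contributes at most a multiple of its `φ_r`-norm. -/
theorem integral_ellNorm_head_le {r : ℝ} (hr : 1 ≤ r) {k : ℕ} {X : Fin k → Ω → ℝ}
    (h : ∀ i, IsSymmetricWeibull r (X i) P) {ρ : ℝ≥0∞} (h1 : 1 ≤ ρ) {d : Fin k → ℝ} :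
    ∫ ω, ellNorm ρ (fun i => if i ∈ head k ρ then d i * X i ω else 0) ∂P ≤
      16 * Real.exp 1 * phiNorm r (fun i : head k ρ => d i) := by
  have hC : 0 < 16 * Real.exp 1 := by positivity
  rw [← div_le_iff₀' hC]
  refine le_csInf (exists_sum_phi_le_one hr _) ?_
  rintro t ⟨ht, hsum⟩
  rw [div_le_iff₀' hC]
  rw [Finset.sum_coe_sort (head k ρ) (fun i => phi r (|d i| / t))] at hsum
  have hbound : ∀ ω, ellNorm ρ (fun i => if i ∈ head k ρ then d i * X i ω else 0) ≤
      Real.exp 1 * t *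
        (8 + ∑ i ∈ head k ρ, 4 * phi r (|d i| / t) * Real.exp (|X i ω| ^ r / 2)) := by
    intro ω
    have hn : ∀ i ∈ head k ρ, 0 ≤ 4 * phi r (|d i| / t) * Real.exp (|X i ω| ^ r / 2) :=
      fun i _ => by have := phi_nonneg r (|d i| / t); positivity
    have hn' := Finset.sum_nonneg hn
    rw [mul_assoc]
    refine ellNorm_head_le h1 (by positivity) fun i hi => ?_
    -- A single term of the admissible sum is at most 1, and `φ_r(x) ≤ 1` forces `x ≤ 1`.
    have hx1 : |d i| / t ≤ 1 := le_one_of_phi_le_one (r := r) (by linarith)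
      ((Finset.single_le_sum (f := fun i => phi r (|d i| / t))
        (fun i _ => phi_nonneg _ _) hi).trans hsum)
    have hk := mul_le_add_phi_mul_exp hr (by positivity) hx1 (abs_nonneg (X i ω))
    have hk2 := Finset.single_le_sum hn hi
    rw [abs_mul]
    calc |d i| * |X i ω| = t * (|d i| / t * |X i ω|) := by field_simp
      _ ≤ _ := mul_le_mul_of_nonneg_left (by linarith) ht.le
  have hint := (integrable_const_add_sum_exp hr h (head k ρ) 8
    (fun i => 4 * phi r (|d i| / t))).const_mul (Real.exp 1 * t)
  calc _ ≤ ∫ ω, Real.exp 1 * t *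
        (8 + ∑ i ∈ head k ρ, 4 * phi r (|d i| / t) * Real.exp (|X i ω| ^ r / 2)) ∂P :=
        integral_mono_of_nonneg (ae_of_all _ fun ω => ellNorm_nonneg h1 _) hint
          (ae_of_all _ hbound)
    _ ≤ Real.exp 1 * t * (8 + 2 * ∑ i ∈ head k ρ, 4 * phi r (|d i| / t)) := by
        rw [integral_const_mul]
        exact mul_le_mul_of_nonneg_left (integral_const_add_sum_exp_le hr h _ _
          fun i => by have := phi_nonneg r (|d i| / t); positivity) (by positivity)
    _ ≤ Real.exp 1 * t * 16 := by
        rw [← Finset.mul_sum]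
        exact mul_le_mul_of_nonneg_left (by linarith) (by positivity)
    _ = _ := by ring

theorem integral_ellNorm_tail_le {r : ℝ} (hr : 1 ≤ r) {k : ℕ} {X : Fin k → Ω → ℝ}
    (h : ∀ i, IsSymmetricWeibull r (X i) P) {ρ : ℝ≥0∞} (h1 : 1 ≤ ρ) {d : Fin k → ℝ} :
    ∫ ω, ellNorm ρ (fun i => if i ∈ tail k ρ then d i * X i ω else 0) ∂P ≤
      3 * (ρ.toReal ^ (1 / r) * ellNorm ρ (fun i : tail k ρ => d i)) := by
  have hB : 0 ≤ ρ.toReal ^ (1 / r) * ellNorm ρ (fun i : tail k ρ => d i) :=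
    mul_nonneg (by positivity) (ellNorm_nonneg h1 _)
  by_cases hρ : ρ = ∞
  · subst hρ
    simpa [tail_top, ellNorm_top] using hB
  obtain ⟨w, hw0, hw1, hw⟩ := ellNorm_mul_le_one_add_sum hr h1 hρ (tail k ρ) d
  set B := ρ.toReal ^ (1 / r) * ellNorm ρ (fun i : tail k ρ => d i)
  calc _ ≤ ∫ ω, B * (1 + ∑ i ∈ tail k ρ, w i * Real.exp (|X i ω| ^ r / 2)) ∂P :=
        integral_mono_of_nonneg (ae_of_all _ fun ω => ellNorm_nonneg h1 _)
          ((integrable_const_add_sum_exp hr h _ _ _).const_mul _)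
          (ae_of_all _ fun ω => hw fun i => X i ω)
    _ ≤ B * (1 + 2 * ∑ i ∈ tail k ρ, w i) := by
        rw [integral_const_mul]
        exact mul_le_mul_of_nonneg_left (integral_const_add_sum_exp_le hr h _ _ hw0) hB
    _ ≤ B * 3 := mul_le_mul_of_nonneg_left (by linarith) hB
    _ = _ := by ring

theorem integral_ellNorm_le {r : ℝ} (hr : 1 ≤ r) {k : ℕ} {X : Fin k → Ω → ℝ}
    (h : ∀ i, IsSymmetricWeibull r (X i) P) {ρ : ℝ≥0∞} (h1 : 1 ≤ ρ) (d : Fin k → ℝ) :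
    ∫ ω, ellNorm ρ (fun i => d i * X i ω) ∂P ≤
      16 * Real.exp 1 * phiNorm r (fun i : head k ρ => d i) +
        3 * (ρ.toReal ^ (1 / r) * ellNorm ρ (fun i : tail k ρ => d i)) := by
  have hi : ∀ S : Finset (Fin k),
      Integrable (fun ω => ellNorm ρ (fun i => if i ∈ S then d i * X i ω else 0)) P := by
    intro S
    have := integrable_ellNorm hr h h1 (fun i => if i ∈ S then d i else 0)
    simpa only [ite_mul, zero_mul] using this
  refine le_trans ?_ (add_le_add (integral_ellNorm_head_le hr h h1)
    (integral_ellNorm_tail_le hr h h1))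
  rw [← integral_add (hi _) (hi _)]
  refine integral_mono (integrable_ellNorm hr h h1 d) ((hi _).add (hi _)) fun ω => ?_
  refine le_trans (le_of_eq ?_) (ellNorm_add_le h1 _ _)
  congr 1
  funext i
  by_cases hi : i ∈ head k ρ <;> simp [mem_tail_iff, hi]

/-- The `φ_r`-norm of any subfamily is at most a multiple of the expected `ℓ_ρ`-norm. -/
theorem phiNorm_le_integral_ellNorm {r : ℝ} (hr : 1 ≤ r) {k : ℕ} {X : Fin k → Ω → ℝ}
    (h : ∀ i, IsSymmetricWeibull r (X i) P) (hX : iIndepFun X P) {ρ : ℝ≥0∞} (h1 : 1 ≤ ρ)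
    (d : Fin k → ℝ) (S : Finset (Fin k)) :
    phiNorm r (fun i : S => d i) ≤
      1 / (1 - Real.exp (-Real.exp (-2))) * ∫ ω, ellNorm ρ (fun i => d i * X i ω) ∂P := by
  set q := 1 - Real.exp (-Real.exp (-2)) with hq
  have hq0 : 0 < q := by simp [hq, Real.exp_pos]
  set E := ∫ ω, ellNorm ρ (fun i => d i * X i ω) ∂P with hE
  have hE0 : 0 ≤ E := integral_nonneg fun ω => ellNorm_nonneg h1 _
  -- It suffices that every `t > E/q` is admissible.
  refine le_of_forall_gt_imp_ge_of_dense fun t ht => ?_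
  have ht0 : 0 < t := lt_of_le_of_lt (by positivity) ht
  refine csInf_le ⟨0, fun s hs => hs.1.le⟩ ⟨ht0, ?_⟩
  rw [Finset.sum_coe_sort S (fun i => phi r (|d i| / t))]
  by_contra! hsum
  -- Zero coefficients are dropped: there `t / |d i|` would be 0, a threshold that is always
  -- reached.
  set T := S.filter fun i => 0 < |d i| with hT
  have hTsum : Real.exp (-2) ≤ ∑ i ∈ T, Real.exp (-(t / |d i|) ^ r) := by
    have e1 : ∑ i ∈ S, phi r (|d i| / t) = ∑ i ∈ T, phi r (|d i| / t) := by
      rw [hT, Finset.sum_filter]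
      refine Finset.sum_congr rfl fun i _ => ?_
      split_ifs with hi
      · rfl
      · have : |d i| = 0 := le_antisymm (not_lt.1 hi) (abs_nonneg _)
        simp [this, phi_zero]
    have e2 : ∑ i ∈ T, phi r (|d i| / t) ≤ Real.exp 2 * ∑ i ∈ T, Real.exp (-(t / |d i|) ^ r) := by
      rw [Finset.mul_sum]
      refine Finset.sum_le_sum fun i hi => ?_
      have hdi : 0 < |d i| := (Finset.mem_filter.1 hi).2
      have := phi_le_exp_mul (r := r) (div_pos hdi ht0)
      rwa [one_div_div] at this
    rw [Real.exp_neg, inv_le_iff_one_le_mul₀' (Real.exp_pos _)]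
    linarith
  have hprob := one_sub_exp_le_prob_exists h hX T (fun i => t / |d i|)
    (fun i _ => by positivity) hTsum
  have hsub : {ω | ∃ i ∈ T, t / |d i| ≤ |X i ω|} ⊆
      {ω | t ≤ ellNorm ρ (fun i => d i * X i ω)} := by
    rintro ω ⟨i, hi, hti⟩
    have hdi : 0 < |d i| := (Finset.mem_filter.1 hi).2
    rw [div_le_iff₀ hdi] at hti
    have := abs_le_ellNorm h1 (fun i => d i * X i ω) i
    simp only [abs_mul] at this
    exact hti.trans (by linarith)
  have hmarkov := mul_meas_ge_le_integral_of_nonneg (μ := P)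
    (ae_of_all _ fun ω => ellNorm_nonneg h1 fun i => d i * X i ω) (integrable_ellNorm hr h h1 d) t
  have hqm := hprob.trans (measureReal_mono hsub)
  have : t * q ≤ E := (mul_le_mul_of_nonneg_left hqm ht0.le).trans hmarkov
  rw [one_div, inv_mul_lt_iff₀ hq0] at ht
  linarith

end Probability

end WeibullSeq

namespace WeibullSeq

/-! ### Sliding windows and the lower bound for the tail -/

theorem card_sliding_window_le {k : ℕ} (m : ℕ) (S : Finset (Fin k)) (l : Fin k) :
    (S.filter fun i : Fin k => (i : ℕ) ≤ l + m ∧ l < i).card ≤ m := by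
  have : (Finset.Ioc (l : ℕ) (l + m)).card = m := by simp
  refine le_of_le_of_eq ?_ this
  refine Finset.card_le_card_of_injOn (fun i => (i : ℕ)) (fun i hi => ?_) Fin.val_injective.injOn
  have hi' := (Finset.mem_filter.1 (Finset.mem_coe.1 hi)).2
  simp only [Finset.coe_Ioc, Set.mem_Ioc]
  exact ⟨hi'.2, hi'.1⟩

theorem card_filter_window {k m : ℕ} {i : Fin k} (hi : m ≤ i) :
    (Finset.univ.filter fun l : Fin k => (i : ℕ) ≤ l + m ∧ l < i).card = m := by
  have e : (Finset.univ.filter fun l : Fin k => (i : ℕ) ≤ l + m ∧ l < i)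
      = Finset.Ico (⟨i - m, by omega⟩ : Fin k) i := by
    ext l
    simp only [Finset.mem_filter, Finset.mem_univ, true_and, Finset.mem_Ico, Fin.le_def]
    omega
  rw [e, Fin.card_Ico]
  simp only
  omega

/-- Double counting: each `l` dominates at most `m` indices `i`, so the sum of `ρ`-th powers grows
by at most `m ≤ e^ρ`. -/
theorem ellNorm_sliding_le {k : ℕ} {ρ : ℝ≥0∞} (h1 : 1 ≤ ρ) (h : ρ ≠ ∞) {m : ℕ}
    (hm : (m : ℝ) ≤ Real.exp ρ.toReal) (S : Finset (Fin k)) {g z : Fin k → ℝ}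
    (hg : ∀ i ∈ S, g i = 0 ∨ ∃ l : Fin k, ((i : ℕ) ≤ l + m ∧ l < i) ∧ |g i| ≤ |z l|) :
    ellNorm ρ (fun i => if i ∈ S then g i else 0) ≤ Real.exp 1 * ellNorm ρ z := by
  have hp : 0 < ρ.toReal := ENNReal.toReal_pos (by rintro rfl; simp at h1) h
  rw [ellNorm_ite h1 h, ellNorm_eq_sum h1 h]
  set p := ρ.toReal with hpdef
  have hz : ∀ l : Fin k, 0 ≤ |z l| ^ p := fun l => by positivity
  have hz' : 0 ≤ ∑ l : Fin k, |z l| ^ p := Finset.sum_nonneg fun l _ => hz l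
  have key : ∑ i ∈ S, |g i| ^ p ≤ m * ∑ l : Fin k, |z l| ^ p := by
    calc ∑ i ∈ S, |g i| ^ p
        ≤ ∑ i ∈ S, ∑ l : Fin k, if (i : ℕ) ≤ l + m ∧ l < i then |z l| ^ p else 0 := by
          refine Finset.sum_le_sum fun i hi => ?_
          have hn : ∀ l ∈ (Finset.univ : Finset (Fin k)),
              0 ≤ if (i : ℕ) ≤ l + m ∧ l < i then |z l| ^ p else 0 :=
            fun l _ => by split_ifs <;> simp [hz]
          rcases hg i hi with h0 | ⟨l, hl, hgl⟩
          · rw [h0, abs_zero, Real.zero_rpow hp.ne']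
            exact Finset.sum_nonneg hn
          · refine le_trans ?_ (Finset.single_le_sum hn (Finset.mem_univ l))
            rw [if_pos hl]
            exact Real.rpow_le_rpow (abs_nonneg _) hgl hp.le
      _ = ∑ l : Fin k, ((S.filter fun i : Fin k => (i : ℕ) ≤ l + m ∧ l < i).card : ℝ) * |z l| ^ p := by
          rw [Finset.sum_comm]
          refine Finset.sum_congr rfl fun l _ => ?_
          rw [← Finset.sum_filter, Finset.sum_const, nsmul_eq_mul]
      _ ≤ ∑ l : Fin k, (m : ℝ) * |z l| ^ p := by
          refine Finset.sum_le_sum fun l _ => mul_le_mul_of_nonneg_right ?_ (hz l)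
          exact_mod_cast card_sliding_window_le m S l
      _ = _ := by rw [Finset.mul_sum]
  calc _ ≤ (m * ∑ l : Fin k, |z l| ^ p) ^ (1 / p) :=
        Real.rpow_le_rpow (Finset.sum_nonneg fun i _ => by positivity) key (by positivity)
    _ = (m : ℝ) ^ (1 / p) * (∑ l : Fin k, |z l| ^ p) ^ (1 / p) := Real.mul_rpow (by positivity) hz'
    _ ≤ _ := mul_le_mul_of_nonneg_right (rpow_one_div_le_exp_one hp (by positivity) hm)
        (by positivity)

/-- Jensen's inequality for `ellNorm`. -/
theorem ellNorm_integral_le {Ω : Type*} [MeasurableSpace Ω] {P : Measure Ω} {ι : Type*}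
    [Fintype ι] {ρ : ℝ≥0∞} (h1 : 1 ≤ ρ) {f : ι → Ω → ℝ}
    (hf : ∀ i, Integrable (f i) P) :
    ellNorm ρ (fun i => ∫ ω, f i ω ∂P) ≤ ∫ ω, ellNorm ρ (fun i => f i ω) ∂P := by
  have : Fact (1 ≤ ρ) := ⟨h1⟩
  have hn := norm_integral_le_integral_norm (μ := P)
    (fun ω => (WithLp.toLp ρ (fun i => f i ω) : PiLp ρ fun _ : ι => ℝ))
  have he : (∫ ω, (WithLp.toLp ρ (fun i => f i ω) : PiLp ρ fun _ : ι => ℝ) ∂P)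
      = WithLp.toLp ρ (fun i => ∫ ω, f i ω ∂P) := by
    ext i
    rw [eval_integral_piLp (fun i => hf i)]
  rw [he] at hn
  exact hn

section Probability

variable {Ω : Type*} [MeasurableSpace Ω] {P : Measure Ω} [IsProbabilityMeasure P]

theorem ellNorm_tail_le_integral_ellNorm {r : ℝ} (hr : 1 ≤ r) {k : ℕ} {X : Fin k → Ω → ℝ}
    (h : ∀ i, IsSymmetricWeibull r (X i) P) (hX : iIndepFun X P) {ρ : ℝ≥0∞} (h1 : 1 ≤ ρ)
    {d : Fin k → ℝ} (hd0 : ∀ i, 0 ≤ d i) (hd : Antitone d) :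
    ρ.toReal ^ (1 / r) * ellNorm ρ (fun i : tail k ρ => d i) ≤
      Real.exp 1 / (1 - Real.exp (-(1 / 2))) * ∫ ω, ellNorm ρ (fun i => d i * X i ω) ∂P := by
  set q := 1 - Real.exp (-(1 / 2 : ℝ)) with hq
  have hq0 : 0 < q := by simp [hq]
  set E := ∫ ω, ellNorm ρ (fun i => d i * X i ω) ∂P with hE
  have hE0 : 0 ≤ E := integral_nonneg fun ω => ellNorm_nonneg h1 _
  by_cases hρ : ρ = ∞
  · subst hρ
    -- For `ρ = ∞`, `ρ.toReal = 0`, so the left side vanishes.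
    have : 0 ≤ Real.exp 1 / q * E := by positivity
    simpa [Real.zero_rpow (inv_ne_zero (by linarith : r ≠ 0))] using this
  have hp1 : 1 ≤ ρ.toReal := (ENNReal.ofReal_le_iff_le_toReal hρ).1 (by simpa using h1)
  have hp : 0 < ρ.toReal := by linarith
  set p := ρ.toReal with hpdef
  set s := p ^ (1 / r) with hs
  have hs0 : 0 < s := by positivity
  have hsr : s ^ r = p := by
    rw [hs, ← Real.rpow_mul hp.le, one_div_mul_cancel (by linarith), Real.rpow_one]
  set m := ⌊Real.exp p⌋₊ with hm
  have hmle : (m : ℝ) ≤ Real.exp p := Nat.floor_le (Real.exp_pos p).le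
  have hmge : Real.exp p / 2 ≤ m := by
    have h2 : 2 ≤ Real.exp p := by have := Real.add_one_le_exp p; linarith
    have := Nat.lt_floor_add_one (Real.exp p)
    linarith
  set W : Fin k → Finset (Fin k) := fun i =>
    Finset.univ.filter fun l : Fin k => (i : ℕ) ≤ l + m ∧ l < i with hW
  set B : Fin k → Set Ω := fun i => {ω | ∃ l ∈ W i, s ≤ |X l ω|} with hB
  have hBm : ∀ i, MeasurableSet (B i) := by
    intro i
    have : B i = ⋃ l ∈ W i, {ω | s ≤ |X l ω|} := by ext ω; simp [hB]
    rw [this]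
    exact Finset.measurableSet_biUnion _ fun l _ =>
      measurableSet_le measurable_const (h l).measurable.abs
  have hBq : ∀ i ∈ tail k ρ, q ≤ P.real (B i) := by
    intro i hi
    refine one_sub_exp_le_prob_exists h hX (W i) (fun _ => s) (fun _ _ => hs0.le) ?_
    -- Positions are 1-based and `i` is 0-based: `m ≤ e^ρ < i + 1` leaves a full window of `m`
    -- predecessors.
    have him : m ≤ i := by
      have h3 := (mem_tail_iff_lt hρ).1 hi
      have h4 : (m : ℝ) < (i : ℝ) + 1 := hmle.trans_lt h3
      have h5 : m < (i : ℕ) + 1 := by exact_mod_cast h4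
      omega
    -- The window's tail probabilities sum to `m e^(-p) ≥ 1/2`.
    rw [Finset.sum_const, card_filter_window him, hsr, nsmul_eq_mul, Real.exp_neg,
      ← div_eq_mul_inv, le_div_iff₀ (Real.exp_pos _)]
    linarith
  set G : Fin k → Ω → ℝ := fun i => (B i).indicator fun _ => d i * s with hG
  have hGi : ∀ i, Integrable (fun ω => if i ∈ tail k ρ then G i ω else 0) P := by
    intro i
    split_ifs
    · exact (integrable_const (d i * s)).indicator (hBm i)
    · exact integrable_const 0
  have hEG : ∫ ω, ellNorm ρ (fun i => if i ∈ tail k ρ then G i ω else 0) ∂P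
      ≤ Real.exp 1 * E := by
    rw [hE, ← integral_const_mul]
    refine integral_mono_of_nonneg (ae_of_all _ fun ω => ellNorm_nonneg h1 _)
      ((integrable_ellNorm hr h h1 d).const_mul _) (ae_of_all _ fun ω => ?_)
    refine ellNorm_sliding_le h1 hρ hmle _ fun i _ => ?_
    by_cases hω : ω ∈ B i
    · right
      obtain ⟨l, hl, hsl⟩ := hω
      have hl' := (Finset.mem_filter.1 hl).2
      refine ⟨l, hl', ?_⟩
      have hω : ω ∈ B i := ⟨l, hl, hsl⟩
      rw [hG]
      simp only [Set.indicator_of_mem hω]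
      rw [abs_mul, abs_mul, abs_of_nonneg (hd0 i), abs_of_nonneg (hd0 l), abs_of_pos hs0]
      exact mul_le_mul (hd hl'.2.le) hsl hs0.le (hd0 l)
    · left
      simp [hG, hω]
  have hlow : q * (s * ellNorm ρ (fun i : tail k ρ => d i)) ≤
      ellNorm ρ (fun i => ∫ ω, (if i ∈ tail k ρ then G i ω else 0) ∂P) := by
    rw [ellNorm_restrict h1 hρ, ← ellNorm_ite h1 hρ, ← ellNorm_const_mul h1 hs0.le,
      ← ellNorm_const_mul h1 hq0.le]
    refine ellNorm_mono h1 fun i => ?_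
    split_ifs with hi
    · rw [hG]
      simp only
      rw [integral_indicator_const _ (hBm i), smul_eq_mul]
      simp only [abs_mul, abs_of_nonneg (hd0 i), abs_of_pos hs0, abs_of_pos hq0,
        abs_of_nonneg (measureReal_nonneg (μ := P) (s := B i))]
      have := mul_le_mul_of_nonneg_right (hBq i hi) (mul_nonneg (hd0 i) hs0.le)
      linarith
    · simp
  have hfin := (hlow.trans (ellNorm_integral_le h1 hGi)).trans hEG
  rw [div_mul_eq_mul_div, le_div_iff₀ hq0]
  linarith

end Probability

theorem rearr_nonneg {k : ℕ} (c : Fin k → ℝ) (i : Fin k) : 0 ≤ rearr c i := abs_nonneg _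

theorem phiNorm_nonneg {ι : Type*} [Fintype ι] (r : ℝ) (c : ι → ℝ) : 0 ≤ phiNorm r c :=
  Real.sInf_nonneg fun _ ht => ht.1.le

end WeibullSeq

/-! ### The two-sided estimate -/

open WeibullSeq in
theorem proposition3p7 :
    ∃ C : ℝ, 0 < C ∧
      ∀ (r : ℝ), 1 ≤ r → r ≤ 2 →
      ∀ (k : ℕ) {Ω : Type*} [MeasurableSpace Ω] (P : Measure Ω) [IsProbabilityMeasure P]
        (X : Fin k → Ω → ℝ),
        (∀ i, WeibullSeq.IsSymmetricWeibull r (X i) P) → iIndepFun X P →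
      ∀ (ρ : ℝ≥0∞), 1 ≤ ρ → ∀ (c : Fin k → ℝ),
        Integrable (fun ω => WeibullSeq.ellNorm ρ (fun i => c i * X i ω)) P ∧
        (∫ ω, WeibullSeq.ellNorm ρ (fun i => c i * X i ω) ∂P) ≤ C * WeibullSeq.weibullBound r ρ c ∧
        WeibullSeq.weibullBound r ρ c ≤
          C * (∫ ω, WeibullSeq.ellNorm ρ (fun i => c i * X i ω) ∂P) := by
  set A₁ := 16 * Real.exp 1 with hA₁
  set A₂ := 1 / (1 - Real.exp (-Real.exp (-2))) with hA₂
  set A₃ := Real.exp 1 / (1 - Real.exp (-(1 / 2 : ℝ))) with hA₃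
  have h₁ : 0 < A₁ := by positivity
  have h₂ : 0 < A₂ := one_div_pos.2 (by simp [Real.exp_pos])
  have h₃ : 0 < A₃ := div_pos (Real.exp_pos _) (by simp)
  refine ⟨A₁ + 3 + (A₂ + A₃), by positivity, ?_⟩
  intro r hr _ k Ω _ P _ X h hX ρ h1 c
  refine ⟨integrable_ellNorm hr h h1 c, ?_⟩
  obtain ⟨σ, hσ⟩ := rearr_eq_comp_perm c
  -- The norm ignores signs and order, so `c` may be replaced by its rearrangement once the
  -- variables are permuted along with it.
  have hE : ∫ ω, ellNorm ρ (fun i => c i * X i ω) ∂P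
      = ∫ ω, ellNorm ρ (fun i => rearr c i * X (σ i) ω) ∂P := by
    congr 1
    funext ω
    rw [← ellNorm_comp_equiv h1 _ σ]
    exact ellNorm_congr h1 fun i => by rw [hσ, abs_mul, abs_mul, abs_abs]
  have h' : ∀ i, IsSymmetricWeibull r (X (σ i)) P := fun i => h (σ i)
  have hX' : iIndepFun (fun i => X (σ i)) P := hX.precomp σ.injective
  have hup := integral_ellNorm_le hr h' h1 (rearr c)
  have hlo₁ := phiNorm_le_integral_ellNorm hr h' hX' h1 (rearr c) (head k ρ)
  have hlo₂ := ellNorm_tail_le_integral_ellNorm hr h' hX' h1 (rearr_nonneg c) (rearr_antitone c)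
  rw [hE]
  have ha : 0 ≤ phiNorm r (fun i : head k ρ => rearr c i) := phiNorm_nonneg _ _
  have hb : 0 ≤ ρ.toReal ^ (1 / r) * ellNorm ρ (fun i : tail k ρ => rearr c i) :=
    mul_nonneg (by positivity) (ellNorm_nonneg h1 _)
  have hE0 : 0 ≤ ∫ ω, ellNorm ρ (fun i => rearr c i * X (σ i) ω) ∂P :=
    integral_nonneg fun ω => ellNorm_nonneg h1 _
  rw [← hA₁] at hup
  rw [← hA₂] at hlo₁
  rw [← hA₃] at hlo₂
  unfold weibullBound
  constructor <;> nlinarith [mul_nonneg h₁.le ha, mul_nonneg h₁.le hb, mul_nonneg h₂.le ha,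
    mul_nonneg h₂.le hb, mul_nonneg h₃.le ha, mul_nonneg h₃.le hb, mul_nonneg h₁.le hE0]
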